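/- Let $\mathbb N=\{1,2,3,\dots\}$. For $p\in\mathbb N$, $p\ge 2$, and a finite set $A\subset\mathbb Z$ put $A_p=\left\{\sum_{i=1}^{\infty} x_i p^{-i} : x_i\in A \text{ for all } i\right\}$. For $l,p\in\mathbb N$ with $p>2$ and $2l<p$, the symmetric S-Cantor set is $C(l,p)=\left(\{0,\dots,l-1\}\cup\{p-l,\dots,p-1\}\right)_p$. For $X,Y\subset\mathbb R$ let $X-Y=\{x-y : x\in X,\ y\in Y\}$. A Cantor set is a nonempty bounded perfect (closed, without isolated points) nowhere dense subset of $\mathbb R$. A gap of $E\subset\mathbb R$ is a bounded connected component of $\mathbb R\setminus E$; a proper component of $E$ is a connected component of $E$ that is not a singleton. An M-Cantorval is a perfect set $E\subset\mathbb R$ that has infinitely many gaps and such that, for every gap $(a,b)$ of $E$ and every $\varepsilon>0$, each of the intervals $(a-\varepsilon,a)$ and $(b,b+\varepsilon)$ contains a gap of $E$ and contains a proper component of $E$. **Corollary.** Let $l_1,l_2,p\in\mathbb N$, $p>2$, $2l_1<p$, $2l_2<p$. Then 1. $C(l_1,p)-C(l_2,p)=[-1,1]$ if and only if $2l_1+l_2\ge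 p$ or $l_1+2l_2\ge p$; 2. $C(l_1,p)-C(l_2,p)$ is a Cantor set if and only if $2l_1+2l_2\le p$; 3. $C(l_1,p)-C(l_2,p)$ is an M-Cantorval if and only if $2l_1+l_2<p$ and $l_1+2l_2<p$ and $2l_1+2l_2>p$. -/

import Mathlib

open scoped Pointwise

/-- The set `A_p` of all reals `∑_{i ≥ 1} x_i / p ^ i` with all digits `x_i` in the finite set
`A ⊂ ℤ`. The digit sequence is indexed from `0`, so `x i` is the digit at `p ^ (i + 1)`. -/
def digitSet (A : Finset ℤ) (p : ℕ) : Set ℝ :=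
  {s | ∃ x : ℕ → ℤ, (∀ i, x i ∈ A) ∧ HasSum (fun i => (x i : ℝ) / (p : ℝ) ^ (i + 1)) s}

/-- The digits `A(l, r, p) = {0, …, l - 1} ∪ {p - r, …, p - 1}`, as integers. -/
noncomputable def sCantorDigits (l r p : ℕ) : Finset ℤ :=
  Finset.Icc (0 : ℤ) ((l : ℤ) - 1) ∪ Finset.Icc ((p : ℤ) - (r : ℤ)) ((p : ℤ) - 1)

/-- The S-Cantor set `C(l, r, p) = A(l, r, p)_p`. -/
def sCantorSet (l r p : ℕ) : Set ℝ :=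
  digitSet (sCantorDigits l r p) p

/-- The symmetric S-Cantor set `C(l, p) = C(l, l, p)`. -/
def symmSCantorSet (l p : ℕ) : Set ℝ :=
  sCantorSet l l p

/-- A Cantor set: a nonempty bounded perfect nowhere dense subset of `ℝ`
(`Perfect` means closed and without isolated points). -/
structure IsCantorSet (C : Set ℝ) : Prop where
  nonempty : C.Nonempty
  bounded : Bornology.IsBounded C
  perfect : Perfect C
  nowhereDense : IsNowhereDense C

/-- `K` is a connected component of the subset `E` of `ℝ`. -/
def IsComponentOf (E K : Set ℝ) : Prop :=
  ∃ x ∈ E, K = connectedComponentIn E x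

/-- A gap of `E`: a bounded component of `ℝ \ E`. -/
def IsGap (E G : Set ℝ) : Prop :=
  IsComponentOf Eᶜ G ∧ Bornology.IsBounded G

/-- A proper component of `E`: a component that is not a singleton. -/
def IsProperComponent (E K : Set ℝ) : Prop :=
  IsComponentOf E K ∧ ¬ ∃ x, K = {x}

/-- `a` is accumulated from the left by members of the family `F` of subsets of `ℝ`. -/
def LeftAccumulatedBy (F : Set ℝ → Prop) (a : ℝ) : Prop :=
  ∀ ε > 0, ∃ S, F S ∧ S ⊆ Set.Ioo (a - ε) a

/-- `b` is accumulated from the right by members of the family `F` of subsets of `ℝ`. -/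
def RightAccumulatedBy (F : Set ℝ → Prop) (b : ℝ) : Prop :=
  ∀ ε > 0, ∃ S, F S ∧ S ⊆ Set.Ioo b (b + ε)

/-- An M-Cantorval: a perfect set with infinitely many gaps, such that both endpoints of every gap
are accumulated by gaps and by proper components. A gap `G` is a nonempty bounded interval with
endpoints `sInf G` and `sSup G`; other gaps and components can only come close to the left
endpoint from the left, and to the right endpoint from the right. -/
structure IsMCantorval (E : Set ℝ) : Prop where
  perfect : Perfect E
  infinite_gaps : {G | IsGap E G}.Infinite
  left_gaps : ∀ G, IsGap E G → LeftAccumulatedBy (IsGap E) (sInf G)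
  left_components : ∀ G, IsGap E G → LeftAccumulatedBy (IsProperComponent E) (sInf G)
  right_gaps : ∀ G, IsGap E G → RightAccumulatedBy (IsGap E) (sSup G)
  right_components : ∀ G, IsGap E G → RightAccumulatedBy (IsProperComponent E) (sSup G)

/-! Subtracting digitwise, the difference set is `E = digitSet D p` with `D` the difference of the
two digit sets. This `D` is a central block `|d| < m` and two outer blocks `p - s < |d| < p`, where
`m = max l₁ l₂` and `s = l₁ + l₂` (`isThreeBlocks_sub`). Everything follows from `p E = D + E` and
`{-1, 0, 1} ⊆ E ⊆ [-1, 1]`.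

If `p ≤ s + m`, each point of `[-p, p]` is within 1 of a digit, so `E` is the whole interval
(`eq_Icc`). Otherwise the points between `m / p` and `(p - s) / p` are missed. If `2 s ≤ p`, a hole
occurs at one position common to all cells of every grid `p⁻ⁿ ℤ`, so `E` is nowhere dense
(`exists_hole`). If `s + m < p < 2 s`, then `D ∪ (D + p)` contains `{0, …, p}`, whence `[0, 1] ⊆ E ∪
(E + 1)`, and two adjacent digits produce an interval in `E` (`mem_or_sub_one_mem`). Each gap
endpoint sees arbitrarily small copies of half of `E` (`exists_right_copy`), which carry both gaps
and intervals.

The three arithmetic conditions exhaust all cases and the three kinds of set exclude one another, so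
these implications are equivalences. -/

/-! ### Digit sets and their self-similarity -/

theorem hasSum_congr_of_eq {f g : ℕ → ℝ} {a b : ℝ} (h : HasSum f a) (hfg : ∀ i, g i = f i)
    (hab : b = a) : HasSum g b := by
  obtain rfl : g = f := funext hfg
  rwa [hab]

theorem mem_digitSet_iff {D : Finset ℤ} {p : ℕ} (hp : 0 < p) (x : ℝ) :
    x ∈ digitSet D p ↔ ∃ d ∈ D, (p : ℝ) * x - d ∈ digitSet D p := by
  have hp' : (p : ℝ) ≠ 0 := by positivity
  constructor
  · rintro ⟨f, hf, hs⟩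
    refine ⟨f 0, hf 0, fun i => f (i + 1), fun i => hf _, ?_⟩
    have h := (hs.mul_left (p : ℝ))
    rw [← hasSum_nat_add_iff' 1] at h
    refine hasSum_congr_of_eq h (fun i => ?_) ?_
    · field_simp
      ring
    · simp only [Finset.sum_range_one, zero_add, pow_one]
      field_simp
  · rintro ⟨d, hd, f, hf, hs⟩
    refine ⟨fun i => Nat.casesOn i d f, fun i => by cases i <;> simp [hd, hf], ?_⟩
    rw [← hasSum_nat_add_iff' 1]
    refine hasSum_congr_of_eq (hs.mul_left ((p : ℝ)⁻¹)) (fun i => ?_) ?_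
    · field_simp
      ring
    · simp only [Finset.sum_range_one, zero_add, pow_one]
      field_simp
      rfl

theorem summable_digits {D : Finset ℤ} {p : ℕ} (hp : 2 ≤ p) {f : ℕ → ℤ} (hf : ∀ i, f i ∈ D) :
    Summable fun i => (f i : ℝ) / (p : ℝ) ^ (i + 1) := by
  obtain ⟨C, hC⟩ := (D.finite_toSet.image fun d : ℤ => |(d : ℝ)|).bddAbove
  have hp' : (2 : ℝ) ≤ p := by exact_mod_cast hp
  have hg : Summable fun i : ℕ => C * (1 / (p : ℝ)) ^ (i + 1) := by
    refine Summable.mul_left _ ?_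
    rw [summable_nat_add_iff (f := fun i => (1 / (p : ℝ)) ^ i) 1]
    exact summable_geometric_of_lt_one (by positivity) (by rw [div_lt_one] <;> linarith)
  refine Summable.of_norm_bounded hg fun i => ?_
  have : |(f i : ℝ)| ≤ C := hC ⟨f i, hf i, rfl⟩
  rw [Real.norm_eq_abs, abs_div, abs_of_nonneg (by positivity : (0 : ℝ) ≤ (p : ℝ) ^ (i + 1)),
    one_div_pow, mul_one_div]
  gcongr

theorem abs_le_one_of_mem_digitSet {D : Finset ℤ} {p : ℕ} (hp : 2 ≤ p)
    (hD : ∀ d ∈ D, |d| < (p : ℤ)) {x : ℝ} (hx : x ∈ digitSet D p) : |x| ≤ 1 := by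
  obtain ⟨f, hf, hs⟩ := hx
  have hp' : (2 : ℝ) ≤ p := by exact_mod_cast hp
  have hg : HasSum (fun i : ℕ => ((p : ℝ) - 1) / (p : ℝ) ^ (i + 1)) 1 := by
    have h := (hasSum_geometric_of_lt_one (r := 1 / (p : ℝ)) (by positivity)
      (by rw [div_lt_one] <;> linarith)).mul_left (((p : ℝ) - 1) / p)
    refine hasSum_congr_of_eq h (fun i => ?_) ?_
    · rw [one_div_pow, pow_succ]
      field_simp
    · have : (p : ℝ) - 1 ≠ 0 := by linarith
      field_simp
  have hb : ∀ i, |(f i : ℝ)| ≤ p - 1 := fun i => by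
    have h := hD _ (hf i)
    have : |f i| ≤ (p : ℤ) - 1 := by omega
    exact_mod_cast this
  have hb' : ∀ i, |(f i : ℝ) / (p : ℝ) ^ (i + 1)| ≤ ((p : ℝ) - 1) / (p : ℝ) ^ (i + 1) := fun i => by
    rw [abs_div, abs_of_nonneg (by positivity : (0 : ℝ) ≤ (p : ℝ) ^ (i + 1))]
    gcongr
    exact hb i
  rw [abs_le]
  exact ⟨hasSum_le (fun i => (abs_le.1 (hb' i)).1) hg.neg hs,
    hasSum_le (fun i => (abs_le.1 (hb' i)).2) hs hg⟩

/-- Coinduction principle: iterating the digit choice expands `x`, and after `n` digits the error is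
a point of `S` divided by `pⁿ`, which tends to 0 because `S` is bounded. -/
theorem subset_digitSet {D : Finset ℤ} {p : ℕ} (hp : 2 ≤ p) {S : Set ℝ} {M : ℝ}
    (hM : ∀ x ∈ S, |x| ≤ M) (hS : ∀ x ∈ S, ∃ d ∈ D, (p : ℝ) * x - d ∈ S) :
    S ⊆ digitSet D p := by
  intro x hx
  have hp' : (2 : ℝ) ≤ p := by exact_mod_cast hp
  choose! g hgD hgS using hS
  let y : ℕ → ℝ := fun n => (fun t => (p : ℝ) * t - g t)^[n] x
  have hy : ∀ n, y (n + 1) = p * y n - g (y n) := fun n => Function.iterate_succ_apply' _ _ _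
  have hyS : ∀ n, y n ∈ S := fun n => by
    induction n with
    | zero => exact hx
    | succ n ih => rw [hy]; exact hgS _ ih
  refine ⟨fun i => g (y i), fun i => hgD _ (hyS i), ?_⟩
  rw [(summable_digits hp fun i => hgD _ (hyS i)).hasSum_iff_tendsto_nat]
  have hsum : ∀ n, ∑ i ∈ Finset.range n, (g (y i) : ℝ) / (p : ℝ) ^ (i + 1)
      = x - y n * (1 / (p : ℝ)) ^ n := fun n => by
    induction n with
    | zero => simp [y]
    | succ n ih =>
      rw [Finset.sum_range_succ, ih, hy, one_div_pow, one_div_pow, pow_succ]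
      field_simp
      ring
  simp only [hsum]
  have h0 : Filter.Tendsto (fun n => y n * (1 / (p : ℝ)) ^ n) Filter.atTop (nhds 0) := by
    have hr : Filter.Tendsto (fun n => M * (1 / (p : ℝ)) ^ n) Filter.atTop (nhds 0) := by
      simpa using (tendsto_pow_atTop_nhds_zero_of_lt_one (r := 1 / (p : ℝ)) (by positivity)
        (by rw [div_lt_one] <;> linarith)).const_mul M
    refine squeeze_zero_norm (fun n => ?_) hr
    rw [norm_mul, Real.norm_eq_abs, Real.norm_of_nonneg (by positivity)]
    gcongr
    exact hM _ (hyS n)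
  simpa using tendsto_const_nhds.sub h0

/-- The closure inherits the one-digit expansion property, since finite unions of closed sets are
closed; `subset_digitSet` then applies to it. -/
theorem isClosed_digitSet {D : Finset ℤ} {p : ℕ} (hp : 2 ≤ p) (hD : ∀ d ∈ D, |d| < (p : ℤ)) :
    IsClosed (digitSet D p) := by
  have hp0 : 0 < p := by omega
  refine isClosed_of_closure_subset (subset_digitSet hp (M := 1) ?_ ?_)
  · have : closure (digitSet D p) ⊆ {x | |x| ≤ 1} :=
      closure_minimal (fun x hx => abs_le_one_of_mem_digitSet hp hD hx)
        (isClosed_le continuous_abs continuous_const)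
    exact this
  · have : closure (digitSet D p) ⊆
        ⋃ d ∈ D, (fun x : ℝ => (p : ℝ) * x - d) ⁻¹' closure (digitSet D p) := by
      refine closure_minimal (fun x hx => ?_) ?_
      · obtain ⟨d, hd, h⟩ := (mem_digitSet_iff hp0 x).1 hx
        simp only [Set.mem_iUnion]
        exact ⟨d, hd, subset_closure h⟩
      · exact D.finite_toSet.isClosed_biUnion fun d _ =>
          isClosed_closure.preimage (by fun_prop)
    intro x hx
    simpa using this hx

theorem digitSet_sub_digitSet (A B : Finset ℤ) {p : ℕ} (hp : 2 ≤ p) :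
    digitSet A p - digitSet B p = digitSet (A - B) p := by
  ext z
  rw [Set.mem_sub]
  constructor
  · rintro ⟨x, ⟨f, hf, hx⟩, y, ⟨g, hg, hy⟩, rfl⟩
    refine ⟨fun i => f i - g i, fun i => Finset.sub_mem_sub (hf i) (hg i), ?_⟩
    refine hasSum_congr_of_eq (hx.sub hy) (fun i => ?_) rfl
    push_cast
    ring
  · rintro ⟨h, hh, hz⟩
    simp only [Finset.mem_sub] at hh
    choose f hf g hg hfg using hh
    have hx := (summable_digits hp hf).hasSum
    have hy := (summable_digits hp hg).hasSum
    refine ⟨_, ⟨f, hf, hx⟩, _, ⟨g, hg, hy⟩, (hx.sub hy).unique ?_⟩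
    refine hasSum_congr_of_eq hz (fun i => ?_) rfl
    rw [← hfg i]
    push_cast
    ring

/-! ### Words and grid cells -/

/-- The integers whose base `p` expansion uses `n` digits from `D`. -/
def digitWords (D : Finset ℤ) (p : ℕ) : ℕ → Set ℤ
  | 0 => {0}
  | n + 1 => {N | ∃ M ∈ digitWords D p n, ∃ d ∈ D, N = p * M + d}

theorem mem_digitSet_iff_words {D : Finset ℤ} {p : ℕ} (hp : 0 < p) (n : ℕ) (x : ℝ) :
    x ∈ digitSet D p ↔ ∃ N ∈ digitWords D p n, (p : ℝ) ^ n * x - N ∈ digitSet D p := by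
  induction n with
  | zero => simp [digitWords]
  | succ n ih =>
    rw [ih]
    constructor
    · rintro ⟨M, hM, h⟩
      obtain ⟨d, hd, h⟩ := (mem_digitSet_iff hp _).1 h
      refine ⟨p * M + d, ⟨M, hM, d, hd, rfl⟩, ?_⟩
      convert h using 1
      push_cast
      ring
    · rintro ⟨_, ⟨M, hM, d, hd, rfl⟩, h⟩
      refine ⟨M, hM, (mem_digitSet_iff hp _).2 ⟨d, hd, ?_⟩⟩
      convert h using 1
      push_cast
      ring

theorem div_pow_mem_digitSet {D : Finset ℤ} {p : ℕ} (hp : 0 < p) {n : ℕ} {N : ℤ}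
    (hN : N ∈ digitWords D p n) {y : ℝ} (hy : y ∈ digitSet D p) :
    ((N : ℝ) + y) / (p : ℝ) ^ n ∈ digitSet D p := by
  refine (mem_digitSet_iff_words hp n _).2 ⟨N, hN, ?_⟩
  convert hy using 1
  field_simp
  ring

/-- Points of the digit set in a cell of the grid of mesh `p⁻ⁿ` come from the two nearest
words. -/
theorem mem_digitSet_cell {D : Finset ℤ} {p : ℕ} (hp : 2 ≤ p) (hD : ∀ d ∈ D, |d| < (p : ℤ))
    {n : ℕ} {j : ℤ} {y : ℝ} (hy : y ∈ Set.Ioo (0 : ℝ) 1)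
    (h : ((j : ℝ) + y) / (p : ℝ) ^ n ∈ digitSet D p) :
    (j ∈ digitWords D p n ∧ y ∈ digitSet D p) ∨
      (j + 1 ∈ digitWords D p n ∧ y - 1 ∈ digitSet D p) := by
  have hp0 : 0 < p := by omega
  obtain ⟨N, hN, h⟩ := (mem_digitSet_iff_words hp0 n _).1 h
  have e : (p : ℝ) ^ n * (((j : ℝ) + y) / (p : ℝ) ^ n) = j + y := by field_simp
  rw [e] at h
  have hb := abs_le.1 (abs_le_one_of_mem_digitSet hp hD h)
  have h1 : (N : ℝ) < j + 2 := by linarith [hy.2, hb.1]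
  have h2 : (j : ℝ) - 1 < N := by linarith [hy.1, hb.2]
  have h1' : N < j + 2 := by exact_mod_cast h1
  have h2' : j - 1 < N := by exact_mod_cast h2
  obtain rfl | rfl : N = j ∨ N = j + 1 := by omega
  · left
    refine ⟨hN, ?_⟩
    convert h using 1
    ring
  · right
    refine ⟨hN, ?_⟩
    convert h using 1
    push_cast
    ring

theorem digitWords_one (D : Finset ℤ) (p : ℕ) : digitWords D p 1 = D := by
  ext d
  simp [digitWords]

theorem exists_inv_pow_lt {p : ℕ} (hp : 2 ≤ p) {C ε : ℝ} (hε : 0 < ε) :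
    ∃ n : ℕ, C / (p : ℝ) ^ n < ε := by
  have hp' : (2 : ℝ) ≤ p := by exact_mod_cast hp
  have h : Filter.Tendsto (fun n => C * (1 / (p : ℝ)) ^ n) Filter.atTop (nhds 0) := by
    simpa using (tendsto_pow_atTop_nhds_zero_of_lt_one (r := 1 / (p : ℝ)) (by positivity)
      (by rw [div_lt_one] <;> linarith)).const_mul C
  obtain ⟨n, hn⟩ := (h.eventually_lt_const hε).exists
  refine ⟨n, ?_⟩
  rwa [one_div_pow, mul_one_div] at hn

/-- Keep the first `n` digits of `x` and replace the tail by a different point of the set: the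
result is another point at distance at most `2 / pⁿ`. -/
theorem preperfect_digitSet {D : Finset ℤ} {p : ℕ} (hp : 2 ≤ p) (hD : ∀ d ∈ D, |d| < (p : ℤ))
    (hnt : (digitSet D p).Nontrivial) : Preperfect (digitSet D p) := by
  have hp0 : 0 < p := by omega
  intro x hx
  rw [accPt_iff_nhds]
  intro U hU
  obtain ⟨ε, hε, hεU⟩ := Metric.mem_nhds_iff.1 hU
  obtain ⟨n, hn⟩ := exists_inv_pow_lt (C := 2) hp hε
  obtain ⟨N, hN, h⟩ := (mem_digitSet_iff_words hp0 n x).1 hx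
  obtain ⟨y, hy, hne⟩ := hnt.exists_ne ((p : ℝ) ^ n * x - N)
  have hpn : (0 : ℝ) < (p : ℝ) ^ n := by positivity
  have key : ((N : ℝ) + y) / (p : ℝ) ^ n - x = (y - ((p : ℝ) ^ n * x - N)) / (p : ℝ) ^ n := by
    field_simp
    ring
  refine ⟨(N + y) / (p : ℝ) ^ n, ⟨hεU ?_, div_pow_mem_digitSet hp0 hN hy⟩, ?_⟩
  · rw [Metric.mem_ball, Real.dist_eq, key, abs_div, abs_of_pos hpn]
    refine lt_of_le_of_lt ?_ hn
    gcongr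
    have h1 := abs_le.1 (abs_le_one_of_mem_digitSet hp hD hy)
    have h2 := abs_le.1 (abs_le_one_of_mem_digitSet hp hD h)
    rw [abs_le]
    constructor <;> linarith
  · rw [← sub_ne_zero, key]
    exact div_ne_zero (sub_ne_zero.2 hne) hpn.ne'

/-! ### Gaps and components of subsets of the line -/

theorem exists_isGap_subset_Ioo {E : Set ℝ} {u x v : ℝ} (hu : u ∈ E) (hv : v ∈ E) (hx : x ∉ E)
    (hux : u < x) (hxv : x < v) : ∃ G, IsGap E G ∧ G ⊆ Set.Ioo u v := by
  have hsub : connectedComponentIn Eᶜ x ⊆ Set.Ioo u v := fun y hy => by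
    have hoc := (isPreconnected_connectedComponentIn (F := Eᶜ) (x := x)).ordConnected
    have hxm : x ∈ connectedComponentIn Eᶜ x := mem_connectedComponentIn hx
    have hE := connectedComponentIn_subset Eᶜ x
    by_contra h
    rw [Set.mem_Ioo, not_and_or, not_lt, not_lt] at h
    rcases h with h | h
    · exact hE (hoc.out hy hxm ⟨h, hux.le⟩) hu
    · exact hE (hoc.out hxm hy ⟨hxv.le, h⟩) hv
  exact ⟨_, ⟨⟨x, hx, rfl⟩, (Metric.isBounded_Ioo u v).subset hsub⟩, hsub⟩

theorem exists_isProperComponent_subset_Ioo {E : Set ℝ} {u c d w : ℝ} (hu : u ∉ E) (hw : w ∉ E)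
    (hcd : Set.Icc c d ⊆ E) (huc : u < c) (hlt : c < d) (hdw : d < w) :
    ∃ K, IsProperComponent E K ∧ K ⊆ Set.Ioo u w := by
  have hcE : c ∈ E := hcd ⟨le_rfl, hlt.le⟩
  have hcm : c ∈ connectedComponentIn E c := mem_connectedComponentIn hcE
  refine ⟨connectedComponentIn E c, ⟨⟨c, hcE, rfl⟩, ?_⟩, fun y hy => ?_⟩
  · rintro ⟨z, hz⟩
    have hsub : Set.Icc c d ⊆ connectedComponentIn E c :=
      isPreconnected_Icc.subset_connectedComponentIn ⟨le_rfl, hlt.le⟩ hcd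
    rw [hz] at hsub
    have h1 : c = z := hsub ⟨le_rfl, hlt.le⟩
    have h2 : d = z := hsub ⟨hlt.le, le_rfl⟩
    exact hlt.ne (h1.trans h2.symm)
  · have hoc := (isPreconnected_connectedComponentIn (F := E) (x := c)).ordConnected
    have hE := connectedComponentIn_subset E c
    by_contra h
    rw [Set.mem_Ioo, not_and_or, not_lt, not_lt] at h
    rcases h with h | h
    · exact hu (hE (hoc.out hy hcm ⟨h, huc.le⟩))
    · exact hw (hE (hoc.out hcm hy ⟨(hlt.trans hdw).le, h⟩))

theorem IsGap.nonempty {E G : Set ℝ} (hG : IsGap E G) : G.Nonempty := by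
  obtain ⟨⟨x, hx, rfl⟩, -⟩ := hG
  exact ⟨x, mem_connectedComponentIn hx⟩

theorem IsGap.sSup_mem {E G : Set ℝ} (hE : IsClosed E) (hG : IsGap E G) :
    sSup G ∈ E ∧ ∃ x < sSup G, Set.Ico x (sSup G) ⊆ Eᶜ := by
  have hne := hG.nonempty
  obtain ⟨⟨x, hx, rfl⟩, hb⟩ := hG
  set G := connectedComponentIn Eᶜ x
  have hxm : x ∈ G := mem_connectedComponentIn hx
  have hGE : G ⊆ Eᶜ := connectedComponentIn_subset Eᶜ x
  have hpre : IsPreconnected G := isPreconnected_connectedComponentIn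
  have hopen : IsOpen G := hE.isOpen_compl.connectedComponentIn
  have hnot : sSup G ∉ G := fun h => by
    obtain ⟨ε, hε, hball⟩ := Metric.isOpen_iff.1 hopen _ h
    have : sSup G + ε / 2 ∈ G := hball (by
      rw [Metric.mem_ball, Real.dist_eq, add_sub_cancel_left, abs_of_pos] <;> linarith)
    linarith [le_csSup hb.bddAbove this]
  have hlt : x < sSup G :=
    lt_of_le_of_ne (le_csSup hb.bddAbove hxm) fun h => hnot (h ▸ hxm)
  refine ⟨?_, x, hlt, fun y hy => ?_⟩
  -- Otherwise adjoining the supremum to `G` gives a larger connected subset of the complement.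
  · by_contra h
    have hcl : sSup G ∈ closure G := csSup_mem_closure hne hb.bddAbove
    have hpre' : IsPreconnected (insert (sSup G) G) :=
      hpre.subset_closure (Set.subset_insert _ _) (Set.insert_subset hcl subset_closure)
    exact hnot (hpre'.subset_connectedComponentIn (Set.mem_insert_of_mem _ hxm)
      (Set.insert_subset h hGE) (Set.mem_insert _ _))
  · obtain ⟨z, hz, hyz⟩ := exists_lt_of_lt_csSup hne hy.2
    exact hGE (hpre.ordConnected.out hxm hz ⟨hy.1, hyz.le⟩)

theorem IsGap.sInf_mem {E G : Set ℝ} (hE : IsClosed E) (hG : IsGap E G) :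
    sInf G ∈ E ∧ ∃ x > sInf G, Set.Ioc (sInf G) x ⊆ Eᶜ := by
  have hne := hG.nonempty
  obtain ⟨⟨x, hx, rfl⟩, hb⟩ := hG
  set G := connectedComponentIn Eᶜ x
  have hxm : x ∈ G := mem_connectedComponentIn hx
  have hGE : G ⊆ Eᶜ := connectedComponentIn_subset Eᶜ x
  have hpre : IsPreconnected G := isPreconnected_connectedComponentIn
  have hopen : IsOpen G := hE.isOpen_compl.connectedComponentIn
  have hnot : sInf G ∉ G := fun h => by
    obtain ⟨ε, hε, hball⟩ := Metric.isOpen_iff.1 hopen _ h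
    have : sInf G - ε / 2 ∈ G := hball (by
      rw [Metric.mem_ball, dist_comm, Real.dist_eq, sub_sub_cancel, abs_of_pos] <;> linarith)
    linarith [csInf_le hb.bddBelow this]
  have hlt : sInf G < x :=
    lt_of_le_of_ne (csInf_le hb.bddBelow hxm) fun h => hnot (h ▸ hxm)
  refine ⟨?_, x, hlt, fun y hy => ?_⟩
  · by_contra h
    have hcl : sInf G ∈ closure G := csInf_mem_closure hne hb.bddBelow
    have hpre' : IsPreconnected (insert (sInf G) G) :=
      hpre.subset_closure (Set.subset_insert _ _) (Set.insert_subset hcl subset_closure)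
    exact hnot (hpre'.subset_connectedComponentIn (Set.mem_insert_of_mem _ hxm)
      (Set.insert_subset h hGE) (Set.mem_insert _ _))
  · obtain ⟨z, hz, hzy⟩ := exists_lt_of_csInf_lt hne hy.1
    exact hGE (hpre.ordConnected.out hz hxm ⟨hzy.le, hy.2⟩)

theorem infinite_gaps_of_rightAccumulated {E : Set ℝ} (hne : ∃ G, IsGap E G)
    (h : ∀ G, IsGap E G → RightAccumulatedBy (IsGap E) (sSup G)) : {G | IsGap E G}.Infinite := by
  intro hfin
  -- A rightmost gap is impossible: another gap lies to its right.
  obtain ⟨G, hG, hmax⟩ := Set.exists_max_image _ sSup hfin hne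
  obtain ⟨G', hG', hsub⟩ := h G hG 1 one_pos
  obtain ⟨x, hx⟩ := hG'.nonempty
  have h1 : sSup G < x := (hsub hx).1
  have h2 : x ≤ sSup G' := le_csSup hG'.2.bddAbove hx
  have h3 : sSup G' ≤ sSup G := hmax G' hG'
  linarith

theorem not_isCantorSet_of_Icc_subset {E : Set ℝ} {a b : ℝ} (hab : a < b)
    (h : Set.Icc a b ⊆ E) : ¬ IsCantorSet E := by
  intro hC
  have h1 : Set.Ioo a b ⊆ interior (closure E) :=
    interior_maximal ((Set.Ioo_subset_Icc_self.trans h).trans subset_closure) isOpen_Ioo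
  rw [show interior (closure E) = ∅ from hC.nowhereDense] at h1
  exact h1 (⟨by linarith, by linarith⟩ : (a + b) / 2 ∈ Set.Ioo a b)

theorem IsMCantorval.not_isCantorSet {E : Set ℝ} (hM : IsMCantorval E) : ¬ IsCantorSet E := by
  obtain ⟨G, hG⟩ := hM.infinite_gaps.nonempty
  obtain ⟨K, ⟨⟨x, hx, rfl⟩, hK⟩, -⟩ := hM.right_components G hG 1 one_pos
  have hxm : x ∈ connectedComponentIn E x := mem_connectedComponentIn hx
  have hnt : (connectedComponentIn E x).Nontrivial := by
    by_contra h
    rw [Set.not_nontrivial_iff] at h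
    exact hK ⟨x, h.eq_singleton_of_mem hxm⟩
  obtain ⟨a, ha, b, hb, hab⟩ := hnt.exists_lt
  exact not_isCantorSet_of_Icc_subset hab
    ((isPreconnected_connectedComponentIn.ordConnected.out ha hb).trans
      (connectedComponentIn_subset E x))

theorem not_isMCantorval_Icc (a b : ℝ) : ¬ IsMCantorval (Set.Icc a b) := by
  intro hM
  obtain ⟨G, hG⟩ := hM.infinite_gaps.nonempty
  obtain ⟨h1, x, hx, hxG⟩ := hG.sSup_mem isClosed_Icc
  obtain ⟨h2, -⟩ := hG.sInf_mem isClosed_Icc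
  obtain ⟨z, hz, hxz⟩ := exists_lt_of_lt_csSup hG.nonempty hx
  have hz' : z ≤ sSup G := le_csSup hG.2.bddAbove hz
  have hz'' : sInf G ≤ z := csInf_le hG.2.bddBelow hz
  have hzE : z ∈ (Set.Icc a b)ᶜ := by
    obtain ⟨⟨y, -, rfl⟩, -⟩ := hG
    exact connectedComponentIn_subset _ _ hz
  exact hzE ⟨h2.1.trans hz'', hz'.trans h1.2⟩

/-! ### Three-block digit sets -/

/-- `D` consists of a central block of radius `m` and two outer blocks of length `s - 1` ending at
`±(p - 1)`. -/
def IsThreeBlocks (D : Finset ℤ) (p : ℕ) (m s : ℤ) : Prop :=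
  ∀ d, d ∈ D ↔ |d| < m ∨ ((p : ℤ) - s < |d| ∧ |d| < p)

namespace IsThreeBlocks

variable {D : Finset ℤ} {p : ℕ} {m s : ℤ}

theorem abs_lt (hD : IsThreeBlocks D p m s) (hmp : m ≤ p) : ∀ d ∈ D, |d| < (p : ℤ) := by
  intro d hd
  rcases (hD d).1 hd with h | h
  · omega
  · exact h.2

theorem neg_mem (hD : IsThreeBlocks D p m s) (hp : 2 ≤ p) (hmp : m ≤ p) {x : ℝ}
    (hx : x ∈ digitSet D p) : -x ∈ digitSet D p := by
  refine subset_digitSet hp (S := -digitSet D p) (M := 1) (fun y hy => ?_) (fun y hy => ?_)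
    (Set.neg_mem_neg.2 hx)
  · rw [← abs_neg]
    exact abs_le_one_of_mem_digitSet hp (hD.abs_lt hmp) hy
  · obtain ⟨d, hd, h⟩ := (mem_digitSet_iff (by omega) _).1 hy
    refine ⟨-d, by rw [hD] at hd ⊢; rwa [abs_neg], ?_⟩
    rw [Set.mem_neg]
    convert h using 1
    push_cast
    ring

theorem neg_mem_iff (hD : IsThreeBlocks D p m s) (hp : 2 ≤ p) (hmp : m ≤ p) {x : ℝ} :
    -x ∈ digitSet D p ↔ x ∈ digitSet D p :=
  ⟨fun h => by simpa using hD.neg_mem hp hmp h, hD.neg_mem hp hmp⟩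

theorem zero_mem (hD : IsThreeBlocks D p m s) (hp : 2 ≤ p) (hm : 1 ≤ m) :
    (0 : ℝ) ∈ digitSet D p :=
  subset_digitSet hp (S := {0}) (M := 0) (by simp)
    (by rintro x rfl; exact ⟨0, (hD 0).2 (Or.inl (by rw [abs_zero]; omega)), by simp⟩) rfl

theorem one_mem (hD : IsThreeBlocks D p m s) (hp : 2 ≤ p) (hs : 2 ≤ s) :
    (1 : ℝ) ∈ digitSet D p := by
  refine subset_digitSet hp (S := {1}) (M := 1) (by simp) ?_ rfl
  rintro x rfl
  refine ⟨p - 1, (hD _).2 (Or.inr ?_), by simp⟩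
  rw [abs_of_nonneg (by omega)]
  omega

theorem neg_one_mem (hD : IsThreeBlocks D p m s) (hp : 2 ≤ p) (hmp : m ≤ p) (hs : 2 ≤ s) :
    (-1 : ℝ) ∈ digitSet D p :=
  hD.neg_mem hp hmp (hD.one_mem hp hs)

theorem perfect (hD : IsThreeBlocks D p m s) (hp : 2 ≤ p) (hmp : m ≤ p) (hs : 2 ≤ s) :
    Perfect (digitSet D p) :=
  ⟨isClosed_digitSet hp (hD.abs_lt hmp), preperfect_digitSet hp (hD.abs_lt hmp)
    ⟨1, hD.one_mem hp hs, -1, hD.neg_one_mem hp hmp hs, by norm_num⟩⟩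

/-- The floor of `t` is itself a digit unless it equals `p - s` or `p`; there the neighbouring digit
on the inner side of the outer block serves. -/
theorem exists_digit_of_nonneg (hD : IsThreeBlocks D p m s) (hm : 1 ≤ m)
    (hs : 2 ≤ s) (hsp : s < p) (hsm : (p : ℤ) ≤ s + m) {t : ℝ} (ht : 0 ≤ t) (htp : t ≤ p) :
    ∃ d ∈ D, |t - d| ≤ 1 := by
  have hf := Int.floor_le t
  have hf' := Int.lt_floor_add_one t
  have h0 : 0 ≤ ⌊t⌋ := Int.floor_nonneg.2 ht
  by_cases h1 : ⌊t⌋ < m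
  · exact ⟨⌊t⌋, (hD _).2 (Or.inl (by rwa [abs_of_nonneg h0])),
      by rw [abs_le]; constructor <;> linarith⟩
  by_cases h2 : ⌊t⌋ = p
  · refine ⟨p - 1, (hD _).2 (Or.inr (by rw [abs_of_nonneg (by omega)]; omega)), ?_⟩
    have : (⌊t⌋ : ℝ) = p := by exact_mod_cast h2
    push_cast
    rw [abs_le]; constructor <;> linarith
  have h3 : ⌊t⌋ ≤ p := by
    have : (⌊t⌋ : ℝ) ≤ ((p : ℤ) : ℝ) := by push_cast; linarith
    exact_mod_cast this
  by_cases h4 : ⌊t⌋ = p - s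
  · refine ⟨p - s + 1, (hD _).2 (Or.inr (by rw [abs_of_nonneg (by omega)]; omega)), ?_⟩
    have : (⌊t⌋ : ℝ) = p - s := by exact_mod_cast h4
    push_cast
    rw [abs_le]; constructor <;> linarith
  · exact ⟨⌊t⌋, (hD _).2 (Or.inr (by rw [abs_of_nonneg h0]; omega)),
      by rw [abs_le]; constructor <;> linarith⟩

theorem eq_Icc (hD : IsThreeBlocks D p m s) (hp : 2 ≤ p) (hmp : m ≤ p) (hm : 1 ≤ m)
    (hs : 2 ≤ s) (hsp : s < p) (hsm : (p : ℤ) ≤ s + m) : digitSet D p = Set.Icc (-1) 1 := by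
  refine Set.Subset.antisymm
    (fun x hx => abs_le.1 (abs_le_one_of_mem_digitSet hp (hD.abs_lt hmp) hx)) ?_
  refine subset_digitSet hp (M := 1) (fun x hx => abs_le.2 hx) fun x hx => ?_
  have hp' : (2 : ℝ) ≤ p := by exact_mod_cast hp
  rcases le_total 0 x with h | h
  · obtain ⟨d, hd, hb⟩ := hD.exists_digit_of_nonneg hm hs hsp hsm (t := p * x) (by positivity)
      (by nlinarith [hx.2])
    exact ⟨d, hd, abs_le.1 hb⟩
  · obtain ⟨d, hd, hb⟩ := hD.exists_digit_of_nonneg hm hs hsp hsm (t := p * -x)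
      (mul_nonneg (by positivity) (by linarith)) (by nlinarith [hx.1])
    refine ⟨-d, by rw [hD] at hd ⊢; rwa [abs_neg], abs_le.1 ?_⟩
    rw [← abs_neg]
    rwa [show -((p : ℝ) * x - ((-d : ℤ) : ℝ)) = p * -x - d by push_cast; ring]

/-- Central digits reach only up to `m - 1 + 1`, positive outer ones only down to `p - s + 1 - 1`.
-/
theorem notMem_of_mem_gap (hD : IsThreeBlocks D p m s) (hp : 2 ≤ p) (hm : 1 ≤ m)
    (hmp : m ≤ p) {z : ℝ}
    (h1 : (m : ℝ) < p * z) (h2 : p * z < p - s) : z ∉ digitSet D p := by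
  intro hz
  obtain ⟨d, hd, h⟩ := (mem_digitSet_iff (by omega) z).1 hz
  have hb := abs_le.1 (abs_le_one_of_mem_digitSet hp (hD.abs_lt hmp) h)
  have h3 : m < d + 1 := by
    have : (m : ℝ) < d + 1 := by linarith [hb.2]
    exact_mod_cast this
  have h4 : d - 1 < p - s := by
    have : (d : ℝ) - 1 < p - s := by linarith [hb.1]
    exact_mod_cast this
  rw [hD] at hd
  rcases abs_cases d with h | h <;> omega

theorem exists_mem_gap (hp : 2 ≤ p) (hsm : s + m < p) :
    ∃ z : ℝ, (m : ℝ) < p * z ∧ p * z < p - s := by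
  have hp' : (2 : ℝ) ≤ p := by exact_mod_cast hp
  have h : (s : ℝ) + m < p := by exact_mod_cast hsm
  obtain ⟨t, h1, h2⟩ := exists_between (show (m : ℝ) < p - s by linarith)
  refine ⟨t / p, ?_⟩
  rw [mul_div_cancel₀ _ (by positivity)]
  exact ⟨h1, h2⟩

theorem exists_hole (hD : IsThreeBlocks D p m s) (hp : 2 ≤ p) (hm : 1 ≤ m)
    (hms : m < s) (hsp : 2 * s ≤ p) :
    ∃ y ∈ Set.Ioo (0 : ℝ) 1, y ∉ digitSet D p ∧ y - 1 ∉ digitSet D p := by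
  have hmp : m ≤ p := by omega
  have hp' : (2 : ℝ) ≤ p := by exact_mod_cast hp
  obtain ⟨z, hz1, hz2⟩ := exists_mem_gap (m := m) (s := s) hp (by omega)
  have hzE := hD.notMem_of_mem_gap hp hm hmp hz1 hz2
  have hm' : (1 : ℝ) ≤ m := by exact_mod_cast hm
  have hs' : (2 : ℝ) ≤ s := by exact_mod_cast (show 2 ≤ s by omega)
  have hsp' : (2 : ℝ) * s ≤ p := by exact_mod_cast hsp
  have hz0 : 0 < z := by
    by_contra h
    nlinarith
  have hz1' : z < 1 := by
    by_contra h
    nlinarith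
  have hD' := hD.abs_lt hmp
  have hpow : ((p : ℝ) ^ 1) = p := pow_one _
  -- Neither `s` nor `s - p` is a digit when `m < s ≤ p - s`, so only the left neighbouring digit
  -- could contribute here, and that would force `z` into the set.
  refine ⟨(((s - 1 : ℤ) : ℝ) + z) / (p : ℝ) ^ 1, ?_, fun h => ?_, fun h => ?_⟩
  · rw [hpow]
    push_cast
    constructor
    · apply div_pos <;> linarith
    · rw [div_lt_one] <;> linarith
  · rcases mem_digitSet_cell hp hD' ⟨hz0, hz1'⟩ h with ⟨-, h⟩ | ⟨h, -⟩
    · exact hzE h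
    · rw [digitWords_one, Finset.mem_coe, hD, abs_of_nonneg (by omega)] at h
      omega
  · have e : (((s - 1 : ℤ) : ℝ) + z) / (p : ℝ) ^ 1 - 1
        = (((s - 1 - p : ℤ) : ℝ) + z) / (p : ℝ) ^ 1 := by
      rw [hpow]
      push_cast
      field_simp
      ring
    rw [e] at h
    rcases mem_digitSet_cell hp hD' ⟨hz0, hz1'⟩ h with ⟨-, h⟩ | ⟨h, -⟩
    · exact hzE h
    · rw [digitWords_one, Finset.mem_coe, hD, abs_of_nonpos (by omega)] at h
      omega

theorem isCantorSet (hD : IsThreeBlocks D p m s) (hp : 2 ≤ p) (hm : 1 ≤ m)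
    (hms : m < s) (hsp : 2 * s ≤ p) : IsCantorSet (digitSet D p) := by
  have hmp : m ≤ p := by omega
  have hD' := hD.abs_lt hmp
  have hE := isClosed_digitSet hp hD'
  refine ⟨⟨0, hD.zero_mem hp hm⟩, (Metric.isBounded_Icc (-1 : ℝ) 1).subset
    fun x hx => abs_le.1 (abs_le_one_of_mem_digitSet hp hD' hx),
    hD.perfect hp hmp (by omega), ?_⟩
  rw [IsNowhereDense, hE.closure_eq, Set.eq_empty_iff_forall_notMem]
  intro x hx
  obtain ⟨ε, hε, hball⟩ := Metric.isOpen_iff.1 isOpen_interior x hx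
  obtain ⟨n, hn⟩ := exists_inv_pow_lt (C := 1) hp hε
  obtain ⟨y, hy, hy1, hy2⟩ := hD.exists_hole hp hm hms hsp
  have hpn : (0 : ℝ) < (p : ℝ) ^ n := by positivity
  -- An interior point would put the hole of its own grid cell inside the set.
  have hmem : ((⌊(p : ℝ) ^ n * x⌋ : ℝ) + y) / (p : ℝ) ^ n ∈ digitSet D p := by
    refine interior_subset (hball ?_)
    have e : ((⌊(p : ℝ) ^ n * x⌋ : ℝ) + y) / (p : ℝ) ^ n - x
        = (⌊(p : ℝ) ^ n * x⌋ + y - (p : ℝ) ^ n * x) / (p : ℝ) ^ n := by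
      field_simp
    rw [Metric.mem_ball, Real.dist_eq, e, abs_div, abs_of_pos hpn]
    refine lt_of_le_of_lt ?_ hn
    have h1 := Int.floor_le ((p : ℝ) ^ n * x)
    have h2 := Int.lt_floor_add_one ((p : ℝ) ^ n * x)
    gcongr
    rw [abs_le]
    constructor <;> linarith [hy.1, hy.2]
  rcases mem_digitSet_cell hp hD' hy hmem with h | h
  · exact hy1 h.2
  · exact hy2 h.2

/-! ### The Cantorval case -/

/-- If `p < 2 * s`, the digits together with their translates by `p` contain `{0, …, p}`. -/
theorem mem_or_sub_mem (hD : IsThreeBlocks D p m s) (hps : (p : ℤ) < 2 * s) (hm : 1 ≤ m)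
    {j : ℤ} (h0 : 0 ≤ j) (hj : j ≤ p) :
    j ∈ D ∨ j - p ∈ D := by
  rw [hD, hD, abs_of_nonneg h0, abs_of_nonpos (by omega)]
  omega

/-- With `W = E ∪ (E + 1)`, `mem_or_sub_mem` gives `(j + W) / p ⊆ W` for `0 ≤ j < p`; these maps
tile `[0, 1]`, and each application shrinks the error by `p`. -/
theorem exists_near (hD : IsThreeBlocks D p m s) (hp : 2 ≤ p) (hm : 1 ≤ m)
    (hps : (p : ℤ) < 2 * s) (n : ℕ) : ∀ x ∈ Set.Icc (0 : ℝ) 1,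
    ∃ w, (w ∈ digitSet D p ∨ w - 1 ∈ digitSet D p) ∧ |x - w| ≤ 1 / (p : ℝ) ^ n := by
  have hp0 : 0 < p := by omega
  have hp' : (2 : ℝ) ≤ p := by exact_mod_cast hp
  have step : ∀ (j : ℤ) (e : ℝ), 0 ≤ j → j ≤ p → e ∈ digitSet D p →
      ((j : ℝ) + e) / p ∈ digitSet D p ∨ ((j : ℝ) + e) / p - 1 ∈ digitSet D p := by
    intro j e h0 hj he
    rcases hD.mem_or_sub_mem hps hm h0 hj with h | h
    · left
      refine (mem_digitSet_iff hp0 _).2 ⟨j, h, ?_⟩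
      convert he using 1
      field_simp
      ring
    · right
      refine (mem_digitSet_iff hp0 _).2 ⟨j - p, h, ?_⟩
      convert he using 1
      push_cast
      field_simp
      ring
  induction n with
  | zero =>
    intro x hx
    refine ⟨0, Or.inl (hD.zero_mem hp hm), ?_⟩
    simpa [abs_of_nonneg hx.1] using hx.2
  | succ n ih =>
    intro x hx
    obtain ⟨j, h0, hj, h1, h2⟩ : ∃ j : ℤ, 0 ≤ j ∧ j + 1 ≤ p ∧ (j : ℝ) ≤ p * x ∧ p * x ≤ j + 1 := by
      -- At `x = 1` the floor would be `p`, one cell too far.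
      rcases hx.2.eq_or_lt with rfl | hlt
      · exact ⟨p - 1, by omega, by omega, by push_cast; linarith, by push_cast; linarith⟩
      · refine ⟨⌊(p : ℝ) * x⌋, Int.floor_nonneg.2 (mul_nonneg (by linarith) hx.1), ?_,
          Int.floor_le _, (Int.lt_floor_add_one _).le⟩
        have : ⌊(p : ℝ) * x⌋ < (p : ℤ) := Int.floor_lt.2 (by push_cast; nlinarith)
        omega
    obtain ⟨w, hw, hxw⟩ := ih (p * x - j) ⟨by linarith, by linarith⟩
    refine ⟨(j + w) / p, ?_, ?_⟩
    · rcases hw with hw | hw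
      · exact step j w h0 (by omega) hw
      · have h := step (j + 1) (w - 1) (by omega) hj hw
        push_cast at h
        rwa [show (j : ℝ) + 1 + (w - 1) = j + w by ring] at h
    · have e : x - (j + w) / p = (p * x - j - w) / p := by
        field_simp
        ring
      rw [e, abs_div, abs_of_pos (by linarith : (0 : ℝ) < p), pow_succ, ← div_div]
      gcongr

theorem mem_or_sub_one_mem (hD : IsThreeBlocks D p m s) (hp : 2 ≤ p) (hmp : m ≤ p) (hm : 1 ≤ m)
    (hps : (p : ℤ) < 2 * s) {x : ℝ} (hx : x ∈ Set.Icc (0 : ℝ) 1) :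
    x ∈ digitSet D p ∨ x - 1 ∈ digitSet D p := by
  have hE := isClosed_digitSet hp (hD.abs_lt hmp)
  have hW : IsClosed (digitSet D p ∪ (fun t : ℝ => t - 1) ⁻¹' digitSet D p) :=
    hE.union (hE.preimage (by fun_prop))
  have hcl : x ∈ closure (digitSet D p ∪ (fun t : ℝ => t - 1) ⁻¹' digitSet D p) := by
    rw [Metric.mem_closure_iff]
    intro ε hε
    obtain ⟨n, hn⟩ := exists_inv_pow_lt (C := 1) hp hε
    obtain ⟨w, hw, hxw⟩ := hD.exists_near hp hm hps n x hx
    exact ⟨w, hw, hxw.trans_lt hn⟩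
  rwa [hW.closure_eq] at hcl

/-- Right of a point of the set that is isolated from the left, the set is a scaled copy of its
part in `(-1, 0)`. -/
theorem exists_right_copy (hD : IsThreeBlocks D p m s) (hp : 2 ≤ p) (hmp : m ≤ p) (hs : 2 ≤ s)
    {b x : ℝ} (hb : b ∈ digitSet D p) (hxb : x < b) (hgap : Set.Ico x b ⊆ (digitSet D p)ᶜ)
    {ε : ℝ} (hε : 0 < ε) :
    ∃ (n : ℕ) (N : ℤ), b = (N - 1) / (p : ℝ) ^ n ∧ 1 / (p : ℝ) ^ n < ε ∧
      ∀ y ∈ Set.Ioo (-1 : ℝ) 0, (N + y) / (p : ℝ) ^ n ∈ digitSet D p ↔ y ∈ digitSet D p := by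
  have hp0 : 0 < p := by omega
  have hD' := hD.abs_lt hmp
  obtain ⟨n, hn⟩ := exists_inv_pow_lt (C := 2) hp (ε := min ε (b - x))
    (lt_min hε (sub_pos.2 hxb))
  have hpn : (0 : ℝ) < (p : ℝ) ^ n := by positivity
  have hnε := hn.trans_le (min_le_left _ _)
  have hnx := hn.trans_le (min_le_right _ _)
  have hle : 1 / (p : ℝ) ^ n ≤ 2 / (p : ℝ) ^ n := by gcongr; norm_num
  obtain ⟨N, hN, h⟩ := (mem_digitSet_iff_words hp0 n b).1 hb
  have h1 := abs_le.1 (abs_le_one_of_mem_digitSet hp hD' h)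
  have hbound : ∀ c ∈ digitSet D p, b - 2 / (p : ℝ) ^ n ≤ c → b ≤ c := fun c hc hbc => by
    by_contra hlt
    exact hgap ⟨by linarith, not_le.1 hlt⟩ hc
  have hN1 := div_pow_mem_digitSet hp0 hN (hD.neg_one_mem hp hmp hs)
  -- The leftmost point of the copy at `N` is within `2 / pⁿ` of `b`, so the gap prevents it from
  -- lying left of `b`.
  have hbN : b = ((N : ℝ) - 1) / (p : ℝ) ^ n := by
    refine le_antisymm (hbound _ hN1 ?_) ?_
    · rw [sub_le_iff_le_add, ← add_div, le_div_iff₀ hpn]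
      linarith [h1.2]
    · rw [div_le_iff₀ hpn]
      linarith [h1.1]
  -- The copy at `N - 1` would place a point at distance `1 / pⁿ` left of `b`, inside the gap.
  have hN2 : N - 1 ∉ digitWords D p n := fun hM => by
    have hM1 := div_pow_mem_digitSet hp0 hM (hD.neg_one_mem hp hmp hs)
    have hbM := hbound _ hM1 (by
      rw [hbN, ← sub_div]
      gcongr
      push_cast
      linarith)
    rw [hbN, div_le_div_iff_of_pos_right hpn] at hbM
    push_cast at hbM
    linarith
  refine ⟨n, N, hbN, hle.trans_lt hnε, fun y hy => ⟨fun h => ?_, div_pow_mem_digitSet hp0 hN⟩⟩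
  have e : (N : ℝ) + y = ((N - 1 : ℤ) : ℝ) + (y + 1) := by
    push_cast
    ring
  rw [e] at h
  rcases mem_digitSet_cell hp hD' ⟨by linarith [hy.1], by linarith [hy.2]⟩ h with h | h
  · exact absurd h.1 hN2
  · simpa using h.2

/-- The mirror image of `exists_right_copy`. -/
theorem exists_left_copy (hD : IsThreeBlocks D p m s) (hp : 2 ≤ p) (hmp : m ≤ p) (hs : 2 ≤ s)
    {a x : ℝ} (ha : a ∈ digitSet D p) (hxa : a < x) (hgap : Set.Ioc a x ⊆ (digitSet D p)ᶜ)
    {ε : ℝ} (hε : 0 < ε) :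
    ∃ (n : ℕ) (N : ℤ), a = (N + 1) / (p : ℝ) ^ n ∧ 1 / (p : ℝ) ^ n < ε ∧
      ∀ y ∈ Set.Ioo (0 : ℝ) 1, (N + y) / (p : ℝ) ^ n ∈ digitSet D p ↔ y ∈ digitSet D p := by
  obtain ⟨n, N, haN, hn, h⟩ := hD.exists_right_copy hp hmp hs (hD.neg_mem hp hmp ha)
    (neg_lt_neg hxa) (fun y hy hyE => hgap ⟨by linarith [hy.2], by linarith [hy.1]⟩
      (hD.neg_mem hp hmp hyE)) hε
  refine ⟨n, -N, ?_, hn, fun y hy => ?_⟩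
  · rw [← neg_neg a, haN]
    push_cast
    ring
  · rw [← hD.neg_mem_iff hp hmp, ← hD.neg_mem_iff hp hmp (x := y),
      ← h (-y) ⟨by linarith [hy.2], by linarith [hy.1]⟩]
    push_cast
    ring_nf

/-- Points of `(-1, 0)` that witness a gap and a proper component. -/
theorem exists_pattern (hD : IsThreeBlocks D p m s) (hp : 2 ≤ p) (hm : 1 ≤ m)
    (hs : 3 ≤ s) (hsm : s + m < p) (hps : (p : ℤ) < 2 * s) :
    ∃ u c d w v : ℝ, -1 < u ∧ u < c ∧ c < d ∧ d < w ∧ w < v ∧ v < 0 ∧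
      u ∉ digitSet D p ∧ w ∉ digitSet D p ∧ v ∈ digitSet D p ∧ Set.Icc c d ⊆ digitSet D p := by
  have hmp : m ≤ p := by omega
  have hp0 : 0 < p := by omega
  have hp' : (2 : ℝ) ≤ p := by exact_mod_cast hp
  have hpos : (0 : ℝ) < p := by linarith
  have hm' : (1 : ℝ) ≤ m := by exact_mod_cast hm
  have hs' : (3 : ℝ) ≤ s := by exact_mod_cast hs
  obtain ⟨z, hz1, hz2⟩ := exists_mem_gap (m := m) (s := s) hp hsm
  have hzE : -z ∉ digitSet D p := fun h =>
    hD.notMem_of_mem_gap hp hm hmp hz1 hz2 ((hD.neg_mem_iff hp hmp).1 h)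
  have hz0 : 0 < z := by
    by_contra h
    nlinarith
  have hz1' : z < 1 := by
    by_contra h
    nlinarith
  -- `u` is the missed point `-z` transplanted into the leftmost cell, reached by no digit but `-(p
  -- - 1)`. The interval `[c, d]` lies between the digits `-(p - 1)` and `-(p - 2)`, both available
  -- since `3 ≤ s`.
  refine ⟨(((-p : ℤ) : ℝ) + (1 - z)) / (p : ℝ) ^ 1, -(p - 1) / p, -(p - 2) / p, -z, -1 / p,
    ?_, ?_, ?_, ?_, ?_, ?_, fun h => ?_, hzE, ?_, fun x hx => ?_⟩
  · rw [pow_one, lt_div_iff₀ hpos]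
    push_cast
    linarith
  · rw [pow_one, div_lt_div_iff_of_pos_right hpos]
    push_cast
    linarith
  · rw [div_lt_div_iff_of_pos_right hpos]
    linarith
  · rw [div_lt_iff₀ hpos]
    linarith
  · rw [lt_div_iff₀ hpos]
    linarith
  · exact div_neg_of_neg_of_pos (by norm_num) hpos
  · rcases mem_digitSet_cell hp (hD.abs_lt hmp) ⟨by linarith, by linarith⟩ h with ⟨h, -⟩ | ⟨-, h⟩
    · rw [digitWords_one, Finset.mem_coe, hD, abs_of_nonpos (by omega)] at h
      omega
    · exact hzE (by simpa using h)
  · refine (mem_digitSet_iff hp0 _).2 ⟨0, (hD 0).2 (Or.inl (by rw [abs_zero]; omega)), ?_⟩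
    rw [mul_div_cancel₀ _ hpos.ne', Int.cast_zero, sub_zero]
    exact hD.neg_one_mem hp hmp (by omega)
  · have h1 := (div_le_iff₀ hpos).1 hx.1
    have h2 := (le_div_iff₀ hpos).1 hx.2
    rcases hD.mem_or_sub_one_mem hp hmp hm hps (x := p * x + (p - 1))
      ⟨by linarith, by linarith⟩ with h | h
    · refine (mem_digitSet_iff hp0 _).2 ⟨-(p - 1), (hD _).2 (Or.inr ?_), ?_⟩
      · rw [abs_of_nonpos (by omega)]
        omega
      · convert h using 1
        push_cast
        ring
    · refine (mem_digitSet_iff hp0 _).2 ⟨-(p - 2), (hD _).2 (Or.inr ?_), ?_⟩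
      · rw [abs_of_nonpos (by omega)]
        omega
      · convert h using 1
        push_cast
        ring

theorem isMCantorval (hD : IsThreeBlocks D p m s) (hp : 2 ≤ p) (hm : 1 ≤ m)
    (hs : 3 ≤ s) (hsm : s + m < p) (hps : (p : ℤ) < 2 * s) : IsMCantorval (digitSet D p) := by
  have hmp : m ≤ p := by omega
  have hE := isClosed_digitSet hp (hD.abs_lt hmp)
  obtain ⟨u, c, d, w, v, hu1, huc, hcd, hdw, hwv, hv0, hu, hw, hv, hI⟩ :=
    hD.exists_pattern hp hm hs hsm hps
  have hc : c ∈ digitSet D p := hI ⟨le_rfl, hcd.le⟩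
  have hright : ∀ G, IsGap (digitSet D p) G → ∀ ε > 0,
      (∃ S, IsGap (digitSet D p) S ∧ S ⊆ Set.Ioo (sSup G) (sSup G + ε)) ∧
      ∃ S, IsProperComponent (digitSet D p) S ∧ S ⊆ Set.Ioo (sSup G) (sSup G + ε) := by
    intro G hG ε hε
    obtain ⟨hb, x, hx, hgap⟩ := hG.sSup_mem hE
    obtain ⟨n, N, hbN, hn, hcopy⟩ := hD.exists_right_copy hp hmp (by omega) hb hx hgap hε
    have hpn : (0 : ℝ) < (p : ℝ) ^ n := by positivity
    have hmono : ∀ {y y' : ℝ}, y < y' → (N + y) / (p : ℝ) ^ n < (N + y') / (p : ℝ) ^ n :=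
      fun h => by gcongr
    have hlow : ∀ y, -1 < y → sSup G < (N + y) / (p : ℝ) ^ n := fun y hy => by
      rw [hbN, sub_eq_add_neg]
      exact hmono hy
    have hhigh : ∀ y, y < 0 → (N + y) / (p : ℝ) ^ n < sSup G + ε := fun y hy => by
      refine (hmono hy).trans ?_
      have : sSup G + 1 / (p : ℝ) ^ n = (N + 0) / (p : ℝ) ^ n := by
        rw [hbN, ← add_div]
        ring
      linarith
    constructor
    · obtain ⟨S, hS, hsub⟩ := exists_isGap_subset_Ioo
        ((hcopy c ⟨by linarith, by linarith⟩).2 hc) ((hcopy v ⟨by linarith, by linarith⟩).2 hv)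
        (mt (hcopy w ⟨by linarith, by linarith⟩).1 hw) (hmono (hcd.trans hdw)) (hmono hwv)
      exact ⟨S, hS, hsub.trans
        (Set.Ioo_subset_Ioo (hlow c (by linarith)).le (hhigh v hv0).le)⟩
    · have hIcc : Set.Icc ((N + c) / (p : ℝ) ^ n) ((N + d) / (p : ℝ) ^ n) ⊆ digitSet D p := by
        intro y hy
        have h1 := (div_le_iff₀ hpn).1 hy.1
        have h2 := (le_div_iff₀ hpn).1 hy.2
        have h := (hcopy (y * (p : ℝ) ^ n - N) ⟨by linarith, by linarith⟩).2
          (hI ⟨by linarith, by linarith⟩)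
        rwa [add_sub_cancel, mul_div_cancel_right₀ _ hpn.ne'] at h
      obtain ⟨S, hS, hsub⟩ := exists_isProperComponent_subset_Ioo
        (mt (hcopy u ⟨by linarith, by linarith⟩).1 hu)
        (mt (hcopy w ⟨by linarith, by linarith⟩).1 hw)
        hIcc (hmono huc) (hmono hcd) (hmono hdw)
      exact ⟨S, hS, hsub.trans
        (Set.Ioo_subset_Ioo (hlow u hu1).le (hhigh w (by linarith)).le)⟩
  have hleft : ∀ G, IsGap (digitSet D p) G → ∀ ε > 0,
      (∃ S, IsGap (digitSet D p) S ∧ S ⊆ Set.Ioo (sInf G - ε) (sInf G)) ∧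
      ∃ S, IsProperComponent (digitSet D p) S ∧ S ⊆ Set.Ioo (sInf G - ε) (sInf G) := by
    intro G hG ε hε
    obtain ⟨hb, x, hx, hgap⟩ := hG.sInf_mem hE
    obtain ⟨n, N, hbN, hn, hcopy⟩ := hD.exists_left_copy hp hmp (by omega) hb hx hgap hε
    have hpn : (0 : ℝ) < (p : ℝ) ^ n := by positivity
    have hcopy' : ∀ y ∈ Set.Ioo (-1 : ℝ) 0,
        (N + -y) / (p : ℝ) ^ n ∈ digitSet D p ↔ y ∈ digitSet D p := fun y hy => by
      rw [hcopy (-y) ⟨by linarith [hy.2], by linarith [hy.1]⟩, hD.neg_mem_iff hp hmp]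
    have hmono : ∀ {y y' : ℝ}, y < y' → (N + -y') / (p : ℝ) ^ n < (N + -y) / (p : ℝ) ^ n :=
      fun h => by gcongr
    have hhigh : ∀ y, -1 < y → (N + -y) / (p : ℝ) ^ n < sInf G := fun y hy => by
      rw [hbN]
      simpa using hmono hy
    have hlow : ∀ y, y < 0 → sInf G - ε < (N + -y) / (p : ℝ) ^ n := fun y hy => by
      refine lt_trans ?_ (hmono hy)
      have : sInf G - 1 / (p : ℝ) ^ n = (N + -0) / (p : ℝ) ^ n := by
        rw [hbN, ← sub_div]
        ring
      linarith
    constructor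
    · obtain ⟨S, hS, hsub⟩ := exists_isGap_subset_Ioo
        ((hcopy' v ⟨by linarith, by linarith⟩).2 hv) ((hcopy' c ⟨by linarith, by linarith⟩).2 hc)
        (mt (hcopy' w ⟨by linarith, by linarith⟩).1 hw) (hmono hwv) (hmono (hcd.trans hdw))
      exact ⟨S, hS, hsub.trans
        (Set.Ioo_subset_Ioo (hlow v hv0).le (hhigh c (by linarith)).le)⟩
    · have hIcc : Set.Icc ((N + -d) / (p : ℝ) ^ n) ((N + -c) / (p : ℝ) ^ n) ⊆ digitSet D p := by
        intro y hy
        have h1 := (div_le_iff₀ hpn).1 hy.1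
        have h2 := (le_div_iff₀ hpn).1 hy.2
        have h := (hcopy' (N - y * (p : ℝ) ^ n) ⟨by linarith, by linarith⟩).2
          (hI ⟨by linarith, by linarith⟩)
        rwa [neg_sub, add_sub_cancel, mul_div_cancel_right₀ _ hpn.ne'] at h
      obtain ⟨S, hS, hsub⟩ := exists_isProperComponent_subset_Ioo
        (mt (hcopy' w ⟨by linarith, by linarith⟩).1 hw)
        (mt (hcopy' u ⟨by linarith, by linarith⟩).1 hu)
        hIcc (hmono hdw) (hmono hcd) (hmono huc)
      exact ⟨S, hS, hsub.trans
        (Set.Ioo_subset_Ioo (hlow w (by linarith)).le (hhigh u hu1).le)⟩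
  have hgap : ∃ G, IsGap (digitSet D p) G := by
    obtain ⟨G, hG, -⟩ := exists_isGap_subset_Ioo hc hv hw (hcd.trans hdw) hwv
    exact ⟨G, hG⟩
  exact ⟨hD.perfect hp hmp (by omega),
    infinite_gaps_of_rightAccumulated hgap fun G hG ε hε => (hright G hG ε hε).1,
    fun G hG ε hε => (hleft G hG ε hε).1, fun G hG ε hε => (hleft G hG ε hε).2,
    fun G hG ε hε => (hright G hG ε hε).1, fun G hG ε hε => (hright G hG ε hε).2⟩

end IsThreeBlocks

/-! ### The difference digits and the trichotomy -/

/-- Low minus low and high minus high together fill the central block; high minus low and low minus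
high give the outer blocks. -/
theorem isThreeBlocks_sub {l₁ l₂ p : ℕ} (hl₁ : 1 ≤ l₁) (hl₂ : 1 ≤ l₂)
    (h₁ : 2 * l₁ < p) (h₂ : 2 * l₂ < p) :
    IsThreeBlocks (sCantorDigits l₁ l₁ p - sCantorDigits l₂ l₂ p) p (max l₁ l₂ : ℕ)
      (l₁ + l₂ : ℕ) := by
  intro d
  simp only [sCantorDigits, Finset.mem_sub, Finset.mem_union, Finset.mem_Icc]
  constructor
  · rintro ⟨a, ha, b, hb, rfl⟩
    rcases abs_cases (a - b) with h | h <;> omega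
  · intro h
    by_cases hlow : |d| < (max l₁ l₂ : ℕ)
    · rw [abs_lt] at hlow
      rcases le_total l₁ l₂ with hl | hl <;> rcases le_total 0 d with h0 | h0
      · exact ⟨p - l₁ + (l₁ - 1), by omega, p - l₁ + (l₁ - 1) - d, by omega, by omega⟩
      · exact ⟨0, by omega, -d, by omega, by omega⟩
      · exact ⟨d, by omega, 0, by omega, by omega⟩
      · exact ⟨p - 1 + d, by omega, p - 1, by omega, by omega⟩
    · have h' := h.resolve_left hlow
      rcases abs_cases d with ⟨e, h0⟩ | ⟨e, h0⟩ <;> rw [e] at h'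
      · by_cases hd : d ≤ p - l₁
        · exact ⟨p - l₁, by omega, p - l₁ - d, by omega, by omega⟩
        · exact ⟨d, by omega, 0, by omega, by omega⟩
      · by_cases hd : -d ≤ p - l₂
        · exact ⟨p - l₂ + d, by omega, p - l₂, by omega, by omega⟩
        · exact ⟨0, by omega, -d, by omega, by omega⟩

theorem corollary8 (l₁ l₂ p : ℕ) (hl₁ : 1 ≤ l₁) (hl₂ : 1 ≤ l₂) (hp : 2 < p)
    (h₁ : 2 * l₁ < p) (h₂ : 2 * l₂ < p) :
    (symmSCantorSet l₁ p - symmSCantorSet l₂ p = Set.Icc (-1 : ℝ) 1 ↔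
      p ≤ 2 * l₁ + l₂ ∨ p ≤ l₁ + 2 * l₂) ∧
    (IsCantorSet (symmSCantorSet l₁ p - symmSCantorSet l₂ p) ↔
      2 * l₁ + 2 * l₂ ≤ p) ∧
    (IsMCantorval (symmSCantorSet l₁ p - symmSCantorSet l₂ p) ↔
      2 * l₁ + l₂ < p ∧ l₁ + 2 * l₂ < p ∧ p < 2 * l₁ + 2 * l₂) := by
  have hD := isThreeBlocks_sub hl₁ hl₂ h₁ h₂
  have hE : symmSCantorSet l₁ p - symmSCantorSet l₂ p
      = digitSet (sCantorDigits l₁ l₁ p - sCantorDigits l₂ l₂ p) p :=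
    digitSet_sub_digitSet _ _ hp.le
  rw [hE]
  set E := digitSet (sCantorDigits l₁ l₁ p - sCantorDigits l₂ l₂ p) p
  have full : p ≤ 2 * l₁ + l₂ ∨ p ≤ l₁ + 2 * l₂ → E = Set.Icc (-1 : ℝ) 1 := fun h =>
    hD.eq_Icc hp.le (by omega) (by omega) (by omega) (by omega) (by omega)
  have cantor : 2 * l₁ + 2 * l₂ ≤ p → IsCantorSet E := fun h =>
    hD.isCantorSet hp.le (by omega) (by omega) (by omega)
  have cantorval : 2 * l₁ + l₂ < p ∧ l₁ + 2 * l₂ < p ∧ p < 2 * l₁ + 2 * l₂ → IsMCantorval E :=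
    -- The bound `3 ≤ s` is automatic: `l₁ = l₂ = 1` would require `3 < p < 4`.
    fun h => hD.isMCantorval hp.le (by omega) (by omega) (by omega) (by omega)
  have full_not_cantor : E = Set.Icc (-1 : ℝ) 1 → ¬ IsCantorSet E := fun h =>
    not_isCantorSet_of_Icc_subset (by norm_num : (-1 : ℝ) < 1) h.ge
  have full_not_cantorval : E = Set.Icc (-1 : ℝ) 1 → ¬ IsMCantorval E := fun h => by
    rw [h]
    exact not_isMCantorval_Icc _ _
  have cantorval_not_cantor : IsMCantorval E → ¬ IsCantorSet E := IsMCantorval.not_isCantorSet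
  by_cases c1 : p ≤ 2 * l₁ + l₂ ∨ p ≤ l₁ + 2 * l₂
  · have hfull := full c1
    exact ⟨iff_of_true hfull c1, iff_of_false (full_not_cantor hfull) (by omega),
      iff_of_false (full_not_cantorval hfull) (by omega)⟩
  by_cases c2 : 2 * l₁ + 2 * l₂ ≤ p
  · have hcantor := cantor c2
    exact ⟨iff_of_false (fun h => full_not_cantor h hcantor) c1, iff_of_true hcantor c2,
      iff_of_false (fun h => cantorval_not_cantor h hcantor) (by omega)⟩
  · have c3 : 2 * l₁ + l₂ < p ∧ l₁ + 2 * l₂ < p ∧ p < 2 * l₁ + 2 * l₂ := by omega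
    have hM := cantorval c3
    exact ⟨iff_of_false (fun h => full_not_cantorval h hM) c1,
      iff_of_false (cantorval_not_cantor hM) c2, iff_of_true hM c3⟩
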